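/- Let $q=e^{2\pi i\tau}$, let $E_4,E_6$ be the normalized Eisenstein series of level one (constant term $1$), $\Delta=(E_4^3-E_6^2)/1728$, and $\eta$ the Dedekind eta function. Put $$\lambda=\Big(\frac{\eta(q^2)}{\eta(q)}\Big)^{24},\qquad g=E_4(q)-2^4E_4(q^2),\qquad W=\begin{pmatrix}0&-1\\2&0\end{pmatrix},$$ write $(f|_kW)(\tau)=2^{k/2}(2\tau)^{-k}f(-1/(2\tau))$ and $\big(\sum_i a_iq^i\big)|U_2=\sum_i a_{2i}q^i$. For integers $n,m\ge1$, Serre's trace construction with $p=2$ gives $$\lambda_{n,m}=\lambda^n g^{3\cdot2^m}+2^{1-6\cdot2^m}\Big(\big(\lambda^n g^{3\cdot2^m}\big)\big|_{12\cdot2^m}W\Big)\Big|U_2 .$$ Let $(x)_k=x(x+1)\cdots(x+k-1)$ and, for $j\ge0$, let $\psi_j=2^{-8j}\,j!\,(3n-3\cdot2^m+1)_{2j}$. Proposition. Let $n,m\ge1$ with $n<2^m$. Then $\psi_j\ne0$ for $0\le j\le 2^m-n$, and, as $q$-series, $$\lambda_{n,m}=\sum_{j=0}^{2^m-n}\psi_j^{-1}\,(3n-3\cdot2^m)_{3j}\,15^{3\cdot2^m}\,E_4^{3\cdot2^m-3n-3j}\,\Delta^{n+j}.$$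 In particular $\lambda_{n,m}$ is (the $q$-expansion of) a modular form of level one and weight $12\cdot2^m$, and it is a weighted homogeneous polynomial in $E_4$ and $E_6$ with complex coefficients. -/

import Mathlib

open UpperHalfPlane ModularForm MatrixGroups

noncomputable section

namespace SerreSequence

/-- The point `2τ` of the upper half plane; `f (double τ)` is `f(q²)`. -/
def double (τ : ℍ) : ℍ := (⟨2, by norm_num⟩ : {x : ℝ // 0 < x}) • τ

/-- The hauptmodul `λ = (η(q²) / η(q))²⁴` on `Γ₀(2)`. -/
def hauptmodul (τ : ℍ) : ℂ := (ModularForm.eta (double τ) / ModularForm.eta τ) ^ 24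

/-- The form `g = E₄(q) - 2⁴ E₄(q²)` of weight `4` on `Γ₀(2)`. -/
def g (τ : ℍ) : ℂ := E₄ τ - 2 ^ 4 * E₄ (double τ)

/-- The matrix `W = (0, -1; 2, 0)`. -/
def W : GL (Fin 2) ℝ :=
  Matrix.GeneralLinearGroup.mkOfDetNeZero !![0, -1; 2, 0] (by simp)

/-- The weight `k` slash operator of a matrix of positive determinant, normalised by
`det(γ)^(k/2)`: `(f ∣ₖ γ)(τ) = det(γ)^(k/2) (cτ + d)^(-k) f(γτ)`.
(Mathlib's slash operator uses `det(γ)^(k-1)` instead.) -/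
def slash (k : ℤ) (f : ℍ → ℂ) (γ : GL (Fin 2) ℝ) (τ : ℍ) : ℂ :=
  (((γ.det.val : ℝ) ^ ((k : ℝ) / 2) : ℝ) : ℂ) * denom γ τ ^ (-k) * f (γ • τ)

/-- The operator `∑ aᵢ qⁱ ↦ ∑ a_{pi} qⁱ` on `q`-series. -/
def U (p : ℕ) (f : PowerSeries ℂ) : PowerSeries ℂ :=
  PowerSeries.mk fun i => PowerSeries.coeff (p * i) f

/-- The function `λⁿ g^(3·2ᵐ)` on the upper half plane. -/
def traceInput (n m : ℕ) (τ : ℍ) : ℂ := hauptmodul τ ^ n * g τ ^ (3 * 2 ^ m)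

/-- The `q`-series
`λ_{n,m} = λⁿ g^(3·2ᵐ) + 2^(1 - 6·2ᵐ) ((λⁿ g^(3·2ᵐ)) ∣_{12·2ᵐ} W) | U₂`. -/
def lam (n m : ℕ) : PowerSeries ℂ :=
  qExpansion 1 (traceInput n m) +
    (2 : ℂ) ^ (1 - 6 * 2 ^ m : ℤ) • U 2 (qExpansion 1 (slash (12 * 2 ^ m) (traceInput n m) W))

/-- The `q`-series `E₄(q)`. -/
def E4q : PowerSeries ℂ := qExpansion 1 E₄

/-- The `q`-series `E₆(q)`. -/
def E6q : PowerSeries ℂ := qExpansion 1 E₆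

/-- The `q`-series `Δ(q) = (E₄(q)³ - E₆(q)²) / 1728`. -/
def Deltaq : PowerSeries ℂ := (1 / 1728 : ℂ) • (E4q ^ 3 - E6q ^ 2)

/-- The rising factorial `(x)_k = x (x + 1) ⋯ (x + k - 1)`. -/
def rising (x : ℂ) (k : ℕ) : ℂ := ∏ i ∈ Finset.range k, (x + i)

/-- `ψ_j = 2^(-8j) j! (3n - 3·2ᵐ + 1)_{2j}`. -/
def psi (n m j : ℕ) : ℂ :=
  (2 : ℂ) ^ (-8 * j : ℤ) * (j.factorial : ℂ) * rising (3 * n - 3 * 2 ^ m + 1) (2 * j)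

end SerreSequence

end

noncomputable section
namespace SerreSequence

open Filter Topology
open scoped Manifold

local notation "𝕢" => Function.Periodic.qParam

/-! The form `-g / 15 = h₀` has three conjugates `h₀, h₁, h₂` under SL₂(ℤ): `S` swaps `h₀` with `h₁`
and fixes `h₂`, `T` swaps `h₁` with `h₂`, up to the weight 4 factor. Their elementary symmetric
functions are level one forms of weights 4, 8, 12, determined by their behaviour at the cusp: `E₄`,
`0`, `-256 Δ` (`sum_h`, `sum_mul_h`, `prod_h`). So the conjugates are the roots of X³ - E₄ X² + 256
Δ.

Moreover λ h₀³ = Δ (`h₀_cube_mul_hauptmodul`). With r = 2^m - n, the input λⁿ g^(3·2^m) is therefore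
15^(3·2^m) h₀^(3r) Δⁿ, and Serre's trace adds the same expression in `h₁` and `h₂`
(`lam_eq_qExpansion`). This leaves the power sum of order 3r of the roots of the cubic, which the
Girard–Waring formula (`sum_pow_eq_girardSum`) writes as a polynomial in `E₄` and `Δ`;
`psi_inv_mul_rising` matches its coefficients with the stated quotients of rising factorials. -/

/-! ### Algebras of functions with a q-expansion -/

/-- Holomorphic functions on the upper half plane that are bounded at `i∞`. -/
def holoBdd : Subalgebra ℂ (ℍ → ℂ) where
  carrier := {f | MDiff f ∧ IsBoundedAtImInfty f}
  mul_mem' hf hg := ⟨hf.1.mul hg.1, hf.2.mul hg.2⟩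
  add_mem' hf hg := ⟨hf.1.add hg.1, hf.2.add hg.2⟩
  algebraMap_mem' c := ⟨mdifferentiable_const, const_boundedAtFilter _ c⟩

/-- Functions on the upper half plane with period one. -/
def periodicFun : Subalgebra ℂ (ℍ → ℂ) where
  carrier := {f | ∀ τ, f ((1 : ℝ) +ᵥ τ) = f τ}
  mul_mem' hf hg τ := by simp [hf τ, hg τ]
  add_mem' hf hg τ := by simp [hf τ, hg τ]
  algebraMap_mem' c τ := rfl

/-- Holomorphic functions of period one that are bounded at `i∞`. -/
def qAlg : Subalgebra ℂ (ℍ → ℂ) := holoBdd ⊓ periodicFun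

lemma periodic_ofComplex {f : ℍ → ℂ} (hf : f ∈ periodicFun) :
    Function.Periodic (f ∘ ofComplex) (1 : ℝ) := by
  intro w
  by_cases! hw : 0 < w.im
  · have h : 0 < (w + (1 : ℝ)).im := by simp [hw]
    simp only [Function.comp_apply, ofComplex_apply_of_im_pos h, ofComplex_apply_of_im_pos hw]
    rw [← hf ⟨w, hw⟩]
    congr 1
    ext
    simp [add_comm]
  · have h : (w + (1 : ℝ)).im ≤ 0 := by simpa using hw
    rw [Function.comp_apply, Function.comp_apply, ofComplex_apply_of_im_nonpos h,
      ofComplex_apply_of_im_nonpos hw]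

lemma analyticAt_cuspFunction {f : ℍ → ℂ} (hf : f ∈ qAlg) :
    AnalyticAt ℂ (cuspFunction 1 f) 0 :=
  analyticAt_cuspFunction_zero one_pos (periodic_ofComplex hf.2) hf.1.1 hf.1.2

lemma hasSum_qExpansion_of_mem {f : ℍ → ℂ} (hf : f ∈ qAlg) (τ : ℍ) :
    HasSum (fun m : ℕ ↦ (qExpansion 1 f).coeff m • Function.Periodic.qParam 1 τ ^ m) (f τ) :=
  τ.hasSum_qExpansion one_pos (periodic_ofComplex hf.2) hf.1.1 hf.1.2

/-- The `q`-expansion as an algebra homomorphism. -/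
def qHom : qAlg →ₐ[ℂ] PowerSeries ℂ :=
  AlgHom.ofLinearMap
    { toFun f := qExpansion 1 f.1
      map_add' f g := qExpansion_add (analyticAt_cuspFunction f.2) (analyticAt_cuspFunction g.2)
      map_smul' c f := qExpansion_smul (analyticAt_cuspFunction f.2) c }
    (qExpansion_one 1)
    (fun f g ↦ qExpansion_mul (analyticAt_cuspFunction f.2) (analyticAt_cuspFunction g.2))

lemma qHom_mk {f : ℍ → ℂ} (hf : f ∈ qAlg) : qHom ⟨f, hf⟩ = qExpansion 1 f := rfl

lemma comp_smul_mem_holoBdd {f : ℍ → ℂ} (hf : f ∈ holoBdd) {γ : GL (Fin 2) ℝ}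
    (hdet : 0 < γ.det.val) (h10 : γ 1 0 = 0) : (fun τ ↦ f (γ • τ)) ∈ holoBdd :=
  ⟨hf.1.comp (mdifferentiable_smul hdet), hf.2.comp_tendsto (tendsto_smul_atImInfty h10)⟩

/-! ### Affine substitutions, doubling and halving -/

/-- The matrix `(a, b; 0, 1)`. -/
def affine (a b : ℝ) (ha : a ≠ 0) : GL (Fin 2) ℝ :=
  Matrix.GeneralLinearGroup.mkOfDetNeZero !![a, b; 0, 1] (by simpa using ha)

lemma coe_affine_smul {a b : ℝ} (ha : 0 < a) (τ : ℍ) :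
    ((affine a b ha.ne' • τ : ℍ) : ℂ) = a * τ + b := by
  rw [coe_smul_of_det_pos (by simpa [affine] using! ha)]
  simp [affine, num, denom]

lemma comp_affine {f : ℍ → ℂ} (hf : f ∈ holoBdd) {a b : ℝ} (ha : 0 < a) {φ : ℍ → ℍ}
    (hφ : ∀ τ, (φ τ : ℂ) = a * τ + b) : (fun τ ↦ f (φ τ)) ∈ holoBdd := by
  have : φ = fun τ ↦ affine a b ha.ne' • τ := by
    ext τ
    rw [hφ, coe_affine_smul ha]
  rw [this]
  exact comp_smul_mem_holoBdd hf (by simpa [affine] using! ha) (by simp [affine])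

lemma tendsto_affine {a b : ℝ} (ha : 0 < a) {φ : ℍ → ℍ}
    (hφ : ∀ τ, (φ τ : ℂ) = a * τ + b) : Tendsto φ atImInfty atImInfty := by
  have : φ = fun τ ↦ affine a b ha.ne' • τ := by
    ext τ
    rw [hφ, coe_affine_smul ha]
  rw [this]
  exact tendsto_smul_atImInfty (by simp [affine])

/-- The point `τ / 2` of the upper half plane. -/
def half (τ : ℍ) : ℍ := (⟨1 / 2, by norm_num⟩ : {x : ℝ // 0 < x}) • τ

lemma coe_double (τ : ℍ) : (double τ : ℂ) = 2 * τ := by simp [double]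

lemma coe_half (τ : ℍ) : (half τ : ℂ) = τ / 2 := by simp [half]; ring

lemma coe_S_smul (τ : ℍ) : ((ModularGroup.S • τ : ℍ) : ℂ) = -1 / τ := by
  rw [modular_S_smul]; simp [neg_div, inv_neg]

lemma half_double (τ : ℍ) : half (double τ) = τ := by
  ext; simp [coe_half, coe_double]

lemma double_half (τ : ℍ) : double (half τ) = τ := by
  ext; simp [coe_half, coe_double]; ring

lemma double_S (τ : ℍ) : double (ModularGroup.S • τ) = ModularGroup.S • half τ := by
  ext; simp only [coe_double, coe_S_smul, coe_half]; field_simp [τ.ne_zero]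

lemma half_S (τ : ℍ) : half (ModularGroup.S • τ) = ModularGroup.S • double τ := by
  ext; simp only [coe_double, coe_S_smul, coe_half]; field_simp [τ.ne_zero]

lemma double_vadd (τ : ℍ) : double ((1 : ℝ) +ᵥ τ) = (1 : ℝ) +ᵥ (1 : ℝ) +ᵥ double τ := by
  ext; simp [coe_double]; ring

lemma half_vadd_vadd (τ : ℍ) : half ((1 : ℝ) +ᵥ (1 : ℝ) +ᵥ τ) = (1 : ℝ) +ᵥ half τ := by
  ext; simp [coe_half]; ring

/-! ### Level one forms determined by their behaviour at the cusp -/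

/-- Weight `k` covariance under `S` and `T`. -/
structure IsLevelOne (k : ℤ) (f : ℍ → ℂ) : Prop where
  mem : f ∈ holoBdd
  T : ∀ τ, f ((1 : ℝ) +ᵥ τ) = f τ
  S : ∀ τ, f (ModularGroup.S • τ) = (τ : ℂ) ^ k * f τ

lemma slash_eq_of_S_of_T {k : ℤ} {f : ℍ → ℂ} (hT : ∀ τ, f ((1 : ℝ) +ᵥ τ) = f τ)
    (hS : ∀ τ, f (ModularGroup.S • τ) = (τ : ℂ) ^ k * f τ) (γ : SL(2, ℤ)) : f ∣[k] γ = f := by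
  refine SlashInvariantForm.slash_action_generators_SL2Z ?_ ?_ γ
  · ext τ
    rw [SL_slash_apply, hS, ModularGroup.denom_S, zpow_neg]
    field_simp [zpow_ne_zero k τ.ne_zero]
  · ext τ
    rw [SL_slash_apply, modular_T_smul, hT]
    rw [ModularGroup.denom_apply]
    simp [ModularGroup.T]

/-- The modular form of level one attached to a function covariant under `S` and `T`. -/
def IsLevelOne.toModularForm {k : ℤ} {f : ℍ → ℂ} (hf : IsLevelOne k f) : ModularForm 𝒮ℒ k where
  toFun := f
  slash_action_eq' A hA := by
    obtain ⟨A, rfl⟩ := hA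
    exact slash_eq_of_S_of_T hf.T hf.S A
  holo' := hf.mem.1
  bdd_at_cusps' hc := by
    rw [Subgroup.IsArithmetic.isCusp_iff_isCusp_SL2Z] at hc
    rw [OnePoint.isBoundedAt_iff_forall_SL2Z hc]
    intro γ _
    rw [slash_eq_of_S_of_T hf.T hf.S]
    exact hf.mem.2

lemma IsLevelOne.coe_toModularForm {k : ℤ} {f : ℍ → ℂ} (hf : IsLevelOne k f) :
    ⇑hf.toModularForm = f := rfl

lemma isLevelOne_of_modularFormClass {k : ℤ} {F : Type*} [FunLike F ℍ ℂ]
    [ModularFormClass F 𝒮ℒ k] (f : F) : IsLevelOne k f where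
  mem := ⟨ModularFormClass.holo f, ModularFormClass.bdd_at_infty f⟩
  T τ := by
    simpa using SlashInvariantForm.vAdd_apply_of_mem_strictPeriods f τ one_mem_strictPeriods_SL
  S τ := by
    have h : (⇑f ∣[k] ModularGroup.S) = f :=
      SlashInvariantFormClass.slash_action_eq f _ ⟨ModularGroup.S, rfl⟩
    have h' := congrFun h τ
    rw [SL_slash_apply, ModularGroup.denom_S, zpow_neg] at h'
    rw [← h', mul_comm, mul_assoc, inv_mul_cancel₀ (zpow_ne_zero k τ.ne_zero), mul_one]

lemma IsLevelOne.mem_qAlg {k : ℤ} {f : ℍ → ℂ} (hf : IsLevelOne k f) : f ∈ qAlg :=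
  ⟨hf.mem, hf.T⟩

lemma IsLevelOne.valueAtInfty_eq {k : ℤ} {f : ℍ → ℂ} (hf : IsLevelOne k f) {c : ℂ}
    (h : Tendsto f atImInfty (𝓝 c)) : (qExpansion 1 f).coeff 0 = c := by
  rw [qExpansion_coeff_zero one_pos (analyticAt_cuspFunction hf.mem_qAlg)
    (periodic_ofComplex hf.T)]
  exact h.limUnder_eq

/-- Below weight 12 the Sturm bound is 0, so the constant term decides. -/
lemma IsLevelOne.eq_zero_of_tendsto {k : ℕ} (hk : k < 12) {f : ℍ → ℂ} (hf : IsLevelOne k f)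
    (h : Tendsto f atImInfty (𝓝 0)) : f = 0 := by
  have : hf.toModularForm = 0 := by
    refine sturm_bound_levelOne_nat ?_
    rw [Nat.div_eq_of_lt hk, hf.coe_toModularForm]
    refine lt_of_lt_of_le (b := ((1 : ℕ) : ℕ∞)) (by norm_num) (PowerSeries.nat_le_order _ _ ?_)
    intro i hi
    obtain rfl : i = 0 := by lia
    exact hf.valueAtInfty_eq h
  simpa [hf.coe_toModularForm] using congrArg (fun F : ModularForm 𝒮ℒ k ↦ (F : ℍ → ℂ)) this

lemma IsLevelOne.sub {k : ℤ} {f f' : ℍ → ℂ} (hf : IsLevelOne k f) (hf' : IsLevelOne k f') :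
    IsLevelOne k (f - f') where
  mem := sub_mem hf.mem hf'.mem
  T τ := by simp [hf.T, hf'.T]
  S τ := by rw [Pi.sub_apply, Pi.sub_apply, hf.S, hf'.S, mul_sub]

lemma isLevelOne_discriminant : IsLevelOne 12 discriminant :=
  isLevelOne_of_modularFormClass CuspForm.discriminant

/-- Cusp forms of weight 12 are spanned by Δ; the limit at the cusp fixes the scalar. -/
lemma IsLevelOne.eq_smul_discriminant {f : ℍ → ℂ} (hf : IsLevelOne 12 f) {c : ℂ}
    (h : Tendsto (fun τ ↦ f τ / discriminant τ) atImInfty (𝓝 c)) :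
    f = c • discriminant := by
  have h0 : Tendsto f atImInfty (𝓝 0) := by
    have := h.mul discriminant_isZeroAtImInfty
    rw [mul_zero] at this
    exact this.congr fun τ ↦ div_mul_cancel₀ _ (discriminant_ne_zero τ)
  obtain ⟨c', hc'⟩ := CuspForm.exists_smul_discriminant_of_weight_eq_twelve
    (toCuspForm hf.toModularForm (hf.valueAtInfty_eq h0))
  have hc : f = c' • discriminant := by
    exact (congrArg (fun F : CuspForm 𝒮ℒ 12 ↦ (F : ℍ → ℂ)) hc').symm
  have : c' = c := by
    refine tendsto_nhds_unique (f := fun _ : ℍ ↦ c') tendsto_const_nhds (h.congr fun τ ↦ ?_)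
    rw [hc]
    exact mul_div_cancel_right₀ _ (discriminant_ne_zero τ)
  rw [hc, this]

/-! ### First-order behaviour at the cusp -/

lemma qParam_ne_zero (τ : ℍ) : 𝕢 1 τ ≠ 0 := by
  simp [Function.Periodic.qParam]

lemma qParam_half_sq (τ : ℍ) : 𝕢 1 (half τ) ^ 2 = 𝕢 1 τ := by
  rw [Function.Periodic.qParam, Function.Periodic.qParam, ← Complex.exp_nat_mul, coe_half]
  congr 1
  push_cast
  ring

lemma qParam_half_vadd (τ : ℍ) : 𝕢 1 (half ((1 : ℝ) +ᵥ τ)) = -𝕢 1 (half τ) := by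
  have : (2 * Real.pi * Complex.I * (half ((1 : ℝ) +ᵥ τ)) / (1 : ℝ) : ℂ) =
      2 * Real.pi * Complex.I * (half τ) / (1 : ℝ) + Real.pi * Complex.I := by
    simp only [coe_half, coe_vadd]
    push_cast
    ring
  rw [Function.Periodic.qParam, Function.Periodic.qParam, this, Complex.exp_add, Complex.exp_pi_mul_I]
  ring

/-- The quotient is the slope at 0 of the cusp function, whose derivative there is the coefficient
of q. -/
lemma tendsto_sub_div_qParam {f : ℍ → ℂ} (hf : f ∈ qAlg) :
    Tendsto (fun τ ↦ (f τ - (qExpansion 1 f).coeff 0) / 𝕢 1 τ) atImInfty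
      (𝓝 ((qExpansion 1 f).coeff 1)) := by
  have hd := (analyticAt_cuspFunction hf).differentiableAt.hasDerivAt
  have h0 : (qExpansion 1 f).coeff 0 = cuspFunction 1 f 0 := by simp [qExpansion_coeff]
  have h1 : (qExpansion 1 f).coeff 1 = deriv (cuspFunction 1 f) 0 := by simp [qExpansion_coeff]
  rw [hasDerivAt_iff_tendsto_slope] at hd
  rw [h0, h1]
  refine (hd.comp ((Function.Periodic.qParam_tendsto one_pos).comp
    tendsto_coe_atImInfty)).congr fun τ ↦ ?_
  simp only [Function.comp_apply, slope_def_field, sub_zero]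
  rw [eq_cuspFunction τ one_ne_zero (periodic_ofComplex hf.2)]

lemma isLevelOne_E₄ : IsLevelOne 4 E₄ := isLevelOne_of_modularFormClass E₄

lemma isLevelOne_E₆ : IsLevelOne 6 E₆ := isLevelOne_of_modularFormClass E₆

lemma qExpansion_E₄_coeff_zero : (qExpansion 1 E₄).coeff 0 = 1 :=
  EisensteinSeries.E_qExpansion_coeff_zero _ ⟨2, rfl⟩

lemma tendsto_E₄_sub_one_div : Tendsto (fun τ ↦ (E₄ τ - 1) / 𝕢 1 τ) atImInfty (𝓝 240) := by
  have := tendsto_sub_div_qParam isLevelOne_E₄.mem_qAlg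
  rwa [qExpansion_E₄_coeff_zero, E₄_qExpansion_coeff_one] at this

lemma tendsto_discriminant_div :
    Tendsto (fun τ ↦ discriminant τ / 𝕢 1 τ) atImInfty (𝓝 1) := by
  have := tendsto_sub_div_qParam isLevelOne_discriminant.mem_qAlg
  rw [isLevelOne_discriminant.valueAtInfty_eq discriminant_isZeroAtImInfty,
    discriminant_qExpansion_coeff_one] at this
  simpa only [sub_zero] using this

lemma tendsto_E₄ : Tendsto E₄ atImInfty (𝓝 1) := by
  have := (tendsto_E₄_sub_one_div.mul (qParam_tendsto_atImInfty one_pos)).add_const 1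
  rw [mul_zero, zero_add] at this
  exact this.congr fun τ ↦ by rw [div_mul_cancel₀ _ (qParam_ne_zero τ), sub_add_cancel]

/-! ### The three conjugates and their cubic equation -/

/-- The conjugate of `-g / 15` fixed by `T`. -/
def h₀ (τ : ℍ) : ℂ := (16 * E₄ (double τ) - E₄ τ) / 15

/-- The conjugate of `-g / 15` expanding in odd powers of `q^(1/2)` to first order `16 q^(1/2)`. -/
def h₁ (τ : ℍ) : ℂ := (E₄ (half τ) - E₄ τ) / 15

/-- The translate of `h₁` by one. -/
def h₂ (τ : ℍ) : ℂ := (E₄ (half ((1 : ℝ) +ᵥ τ)) - E₄ τ) / 15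

lemma coe_double' (τ : ℍ) : (double τ : ℂ) = (2 : ℝ) * τ + (0 : ℝ) := by simp [coe_double]

lemma coe_half' (τ : ℍ) : (half τ : ℂ) = (1 / 2 : ℝ) * τ + (0 : ℝ) := by
  simp [coe_half]; ring

lemma coe_half_vadd (τ : ℍ) : (half ((1 : ℝ) +ᵥ τ) : ℂ) = (1 / 2 : ℝ) * τ + (1 / 2 : ℝ) := by
  simp [coe_half]; ring

lemma tendsto_half : Tendsto half atImInfty atImInfty :=
  tendsto_affine (by norm_num) coe_half'

lemma tendsto_double : Tendsto double atImInfty atImInfty :=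
  tendsto_affine (by norm_num) coe_double'

lemma div_mem {f : ℍ → ℂ} (hf : f ∈ holoBdd) (c : ℂ) : (fun τ ↦ f τ / c) ∈ holoBdd := by
  have : (fun τ ↦ f τ / c) = c⁻¹ • f := by ext τ; simp [div_eq_inv_mul]
  exact this ▸ holoBdd.smul_mem hf _

lemma h₀_mem : h₀ ∈ holoBdd :=
  div_mem (sub_mem (holoBdd.smul_mem
    (comp_affine isLevelOne_E₄.mem (by norm_num) coe_double') 16) isLevelOne_E₄.mem) 15

lemma h₁_mem : h₁ ∈ holoBdd :=
  div_mem (sub_mem (comp_affine isLevelOne_E₄.mem (by norm_num) coe_half') isLevelOne_E₄.mem) 15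

lemma h₂_mem : h₂ ∈ holoBdd :=
  div_mem (sub_mem (comp_affine isLevelOne_E₄.mem (by norm_num) coe_half_vadd) isLevelOne_E₄.mem) 15

lemma h₀_T (τ : ℍ) : h₀ ((1 : ℝ) +ᵥ τ) = h₀ τ := by
  simp only [h₀, double_vadd, isLevelOne_E₄.T]

lemma h₁_T (τ : ℍ) : h₁ ((1 : ℝ) +ᵥ τ) = h₂ τ := by
  simp only [h₁, h₂, isLevelOne_E₄.T]

lemma h₂_T (τ : ℍ) : h₂ ((1 : ℝ) +ᵥ τ) = h₁ τ := by
  simp only [h₁, h₂, half_vadd_vadd, isLevelOne_E₄.T]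

lemma h₀_S (τ : ℍ) : h₀ (ModularGroup.S • τ) = (τ : ℂ) ^ (4 : ℤ) * h₁ τ := by
  simp only [h₀, h₁, double_S, isLevelOne_E₄.S, coe_half, div_zpow]
  norm_num
  ring

lemma h₁_S (τ : ℍ) : h₁ (ModularGroup.S • τ) = (τ : ℂ) ^ (4 : ℤ) * h₀ τ := by
  simp only [h₀, h₁, half_S, isLevelOne_E₄.S, coe_double, mul_zpow]
  norm_num
  ring

lemma E₄_vadd_neg (τ : ℍ) : E₄ ((-1 : ℝ) +ᵥ τ) = E₄ τ := by
  rw [← isLevelOne_E₄.T, vadd_vadd]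
  simp

/-- This is (1, 1; 0, 2) S = -γ (1, 1; 0, 2) with γ = S T⁻² S T⁻¹ in SL₂(ℤ), spelled as a word in
the generators so that the covariance of `E₄` applies letter by letter. -/
lemma half_vadd_S (τ : ℍ) : half ((1 : ℝ) +ᵥ (ModularGroup.S • τ)) = ModularGroup.S •
    ((-1 : ℝ) +ᵥ (-1 : ℝ) +ᵥ ModularGroup.S • ((-1 : ℝ) +ᵥ half ((1 : ℝ) +ᵥ τ))) := by
  have h1 : (τ : ℂ) ≠ 0 := τ.ne_zero
  have h2 : (((-1 : ℝ) +ᵥ half ((1 : ℝ) +ᵥ τ) : ℍ) : ℂ) ≠ 0 := UpperHalfPlane.ne_zero _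
  have h3 : (((-1 : ℝ) +ᵥ (-1 : ℝ) +ᵥ
      ModularGroup.S • ((-1 : ℝ) +ᵥ half ((1 : ℝ) +ᵥ τ)) : ℍ) : ℂ) ≠ 0 :=
    UpperHalfPlane.ne_zero _
  ext
  rw [coe_S_smul, eq_div_iff h3]
  simp only [coe_half, coe_vadd, coe_S_smul] at h2 ⊢
  push_cast at h2 ⊢
  have h4 : (-2 + (1 + τ) : ℂ) ≠ 0 := by
    intro h; apply h2; linear_combination h / 2
  rw [show (-1 + (1 + τ) / 2 : ℂ) = (-2 + (1 + τ)) / 2 by ring]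
  field_simp
  ring

lemma h₂_S (τ : ℍ) : h₂ (ModularGroup.S • τ) = (τ : ℂ) ^ (4 : ℤ) * h₂ τ := by
  have h2 : (((-1 : ℝ) +ᵥ half ((1 : ℝ) +ᵥ τ) : ℍ) : ℂ) ≠ 0 := UpperHalfPlane.ne_zero _
  rw [h₂, half_vadd_S, isLevelOne_E₄.S, E₄_vadd_neg, E₄_vadd_neg, isLevelOne_E₄.S, E₄_vadd_neg,
    isLevelOne_E₄.S, h₂, ← mul_assoc, ← mul_zpow]
  -- The factors from the two occurrences of `S` multiply to -τ; the sign disappears in even weight.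
  rw [show (((-1 : ℝ) +ᵥ (-1 : ℝ) +ᵥ
      ModularGroup.S • ((-1 : ℝ) +ᵥ half ((1 : ℝ) +ᵥ τ)) : ℍ) : ℂ) *
      (((-1 : ℝ) +ᵥ half ((1 : ℝ) +ᵥ τ) : ℍ) : ℂ) = -τ by
    rw [coe_vadd, coe_vadd, coe_S_smul]
    field_simp
    simp only [coe_half, coe_vadd]
    push_cast
    ring]
  rw [Even.neg_zpow (by decide)]
  ring

lemma tendsto_h₀ : Tendsto h₀ atImInfty (𝓝 1) := by
  have := (((tendsto_E₄.comp tendsto_double).const_mul 16).sub tendsto_E₄).div_const 15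
  norm_num at this
  exact this

/-- 16 = 240 / 15: the q-term of E₄(τ/2) is 240 q^(1/2), while E₄(τ) - 1 is of order q and drops
out. -/
lemma tendsto_h₁_div : Tendsto (fun τ ↦ h₁ τ / 𝕢 1 (half τ)) atImInfty (𝓝 16) := by
  have h1 := tendsto_E₄_sub_one_div.comp tendsto_half
  have h2 := tendsto_E₄_sub_one_div.mul ((qParam_tendsto_atImInfty one_pos).comp tendsto_half)
  have h3 := (h1.sub h2).div_const 15
  norm_num at h3
  refine h3.congr fun τ ↦ ?_
  have := qParam_ne_zero (half τ)
  simp only [h₁, ← qParam_half_sq τ]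
  field_simp
  ring

lemma tendsto_h₂_div : Tendsto (fun τ ↦ h₂ τ / 𝕢 1 (half τ)) atImInfty (𝓝 (-16)) := by
  have hT : Tendsto (fun τ : ℍ ↦ (1 : ℝ) +ᵥ τ) atImInfty atImInfty :=
    tendsto_affine (a := 1) (b := 1) one_pos fun τ ↦ by simp [add_comm]
  refine (tendsto_h₁_div.comp hT).neg.congr fun τ ↦ ?_
  simp only [Function.comp_apply, h₁_T, qParam_half_vadd, div_neg, neg_neg]

lemma tendsto_qParam_half : Tendsto (fun τ : ℍ ↦ 𝕢 1 (half τ)) atImInfty (𝓝 0) :=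
  (qParam_tendsto_atImInfty one_pos).comp tendsto_half

lemma tendsto_h₁ : Tendsto h₁ atImInfty (𝓝 0) := by
  have := tendsto_h₁_div.mul tendsto_qParam_half
  rw [mul_zero] at this
  exact this.congr fun τ ↦ div_mul_cancel₀ _ (qParam_ne_zero _)

lemma tendsto_h₂ : Tendsto h₂ atImInfty (𝓝 0) := by
  have := tendsto_h₂_div.mul tendsto_qParam_half
  rw [mul_zero] at this
  exact this.congr fun τ ↦ div_mul_cancel₀ _ (qParam_ne_zero _)

lemma sum_h (τ : ℍ) : h₀ τ + h₁ τ + h₂ τ = E₄ τ := by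
  have hl : IsLevelOne 4 (h₀ + h₁ + h₂ - E₄) := by
    refine IsLevelOne.sub ⟨add_mem (add_mem h₀_mem h₁_mem) h₂_mem, fun τ ↦ ?_, fun τ ↦ ?_⟩
      isLevelOne_E₄
    · simp only [Pi.add_apply, h₀_T, h₁_T, h₂_T]; ring
    · simp only [Pi.add_apply, h₀_S, h₁_S, h₂_S]; ring
  have := hl.eq_zero_of_tendsto (k := 4) (by norm_num) (by
    have := ((tendsto_h₀.add tendsto_h₁).add tendsto_h₂).sub tendsto_E₄
    norm_num at this
    exact this)
  exact sub_eq_zero.mp (congrFun this τ)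

lemma sum_mul_h (τ : ℍ) : h₀ τ * h₁ τ + h₁ τ * h₂ τ + h₂ τ * h₀ τ = 0 := by
  have hl : IsLevelOne 8 (h₀ * h₁ + h₁ * h₂ + h₂ * h₀) := by
    refine ⟨add_mem (add_mem (mul_mem h₀_mem h₁_mem) (mul_mem h₁_mem h₂_mem))
      (mul_mem h₂_mem h₀_mem), fun τ ↦ ?_, fun τ ↦ ?_⟩
    · simp only [Pi.add_apply, Pi.mul_apply, h₀_T, h₁_T, h₂_T]; ring
    · simp only [Pi.add_apply, Pi.mul_apply, h₀_S, h₁_S, h₂_S, zpow_ofNat]; ring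
  have := hl.eq_zero_of_tendsto (k := 8) (by norm_num) (by
    have := ((tendsto_h₀.mul tendsto_h₁).add (tendsto_h₁.mul tendsto_h₂)).add
      (tendsto_h₂.mul tendsto_h₀)
    norm_num at this
    exact this)
  exact congrFun this τ

lemma prod_h (τ : ℍ) : h₀ τ * h₁ τ * h₂ τ = -256 * discriminant τ := by
  have hl : IsLevelOne 12 (h₀ * h₁ * h₂) := by
    refine ⟨mul_mem (mul_mem h₀_mem h₁_mem) h₂_mem, fun τ ↦ ?_, fun τ ↦ ?_⟩
    · simp only [Pi.mul_apply, h₀_T, h₁_T, h₂_T]; ring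
    · simp only [Pi.mul_apply, h₀_S, h₁_S, h₂_S, zpow_ofNat]; ring
  -- -256 = 1 · 16 · (-16), the product of the leading coefficients; the two factors q^(1/2) give
  -- the q of Δ.
  have := hl.eq_smul_discriminant (c := -256) (by
    have := ((tendsto_h₀.mul tendsto_h₁_div).mul tendsto_h₂_div).div tendsto_discriminant_div
      one_ne_zero
    norm_num at this
    refine this.congr fun τ ↦ ?_
    have h1 := qParam_ne_zero (half τ)
    have h2 := discriminant_ne_zero τ
    simp only [Pi.mul_apply, Pi.div_apply, ← qParam_half_sq τ]
    field_simp)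
  exact congrFun this τ

/-- Each of `h₀, h₁, h₂` is a root of `X³ - E₄ X² + 256 Δ`. -/
lemma h₀_root (τ : ℍ) : h₀ τ ^ 3 = E₄ τ * h₀ τ ^ 2 - 256 * discriminant τ := by
  linear_combination h₀ τ ^ 2 * sum_h τ - h₀ τ * sum_mul_h τ + prod_h τ

lemma h₁_root (τ : ℍ) : h₁ τ ^ 3 = E₄ τ * h₁ τ ^ 2 - 256 * discriminant τ := by
  linear_combination h₁ τ ^ 2 * sum_h τ - h₁ τ * sum_mul_h τ + prod_h τ

lemma h₂_root (τ : ℍ) : h₂ τ ^ 3 = E₄ τ * h₂ τ ^ 2 - 256 * discriminant τ := by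
  linear_combination h₂ τ ^ 2 * sum_h τ - h₂ τ * sum_mul_h τ + prod_h τ

/-- Applying `W` to the cubic equation of `h₀`. -/
lemma h₀_cube_mul_discriminant_double (τ : ℍ) :
    h₀ τ ^ 3 * discriminant (double τ) = discriminant τ ^ 2 := by
  have hr := h₀_root τ
  have hd := h₁_root (double τ)
  rw [h₁, half_double] at hd
  rw [h₀] at hr ⊢
  -- Put k = h₁(2τ). Then E₄(τ) - h₀ = 16 k and E₄(2τ) - k = h₀, so the cubics read 16 Δ(τ) = h₀² k
  -- and 256 Δ(2τ) = h₀ k².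
  grind

lemma hauptmodul_eq (τ : ℍ) : hauptmodul τ = discriminant (double τ) / discriminant τ := by
  rw [hauptmodul, div_pow]; rfl

lemma h₀_cube_mul_hauptmodul (τ : ℍ) : h₀ τ ^ 3 * hauptmodul τ = discriminant τ := by
  rw [hauptmodul_eq, ← mul_div_assoc, h₀_cube_mul_discriminant_double, sq,
    mul_div_cancel_right₀ _ (discriminant_ne_zero τ)]

/-! ### Girard–Waring coefficients, rising factorials and power sums -/

/-- The coefficients `(m + 3i) / (m + i) * (m + i).choose i` of the power sums of the roots of
`X³ - a X² + b`. -/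
def girard : ℕ → ℕ → ℕ
  | 0, _ => 3
  | _ + 1, 0 => 1
  | m + 1, i + 1 => girard m (i + 1) + girard (m + 1) i

lemma girard_mul_factorial (m i s : ℕ) (h : m + i = s + 1) :
    girard m i * i.factorial * m.factorial = (m + 3 * i) * s.factorial := by
  induction s generalizing m i with
  | zero =>
    obtain ⟨rfl, rfl⟩ | ⟨rfl, rfl⟩ : (m = 0 ∧ i = 1) ∨ (m = 1 ∧ i = 0) := by lia
    all_goals simp [girard]
  | succ s ih =>
    match m, i with
    | 0, i + 1 =>
      obtain rfl : i = s + 1 := by lia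
      simp only [girard, Nat.factorial, Nat.succ_eq_add_one]
      ring
    | m + 1, 0 =>
      obtain rfl : m = s + 1 := by lia
      simp only [girard, Nat.factorial, Nat.succ_eq_add_one]
      ring
    | m + 1, i + 1 =>
      have h1 := ih m (i + 1) (by lia)
      have h2 := ih (m + 1) i (by lia)
      obtain rfl : s = m + i := by lia
      simp only [girard, Nat.factorial, Nat.succ_eq_add_one] at h1 h2 ⊢
      linear_combination (m + 1) * h1 + (i + 1) * h2

lemma rising_succ (x : ℂ) (k : ℕ) : rising x (k + 1) = x * rising (x + 1) k := by
  rw [rising, Finset.prod_range_succ', rising, mul_comm]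
  congr 1
  · simp
  · refine Finset.prod_congr rfl fun i _ ↦ ?_
    push_cast
    ring

lemma rising_neg_mul_factorial (s k : ℕ) :
    rising (-(s + k : ℂ)) k * s.factorial = (-1) ^ k * (s + k).factorial := by
  induction k with
  | zero => simp [rising]
  | succ k ih =>
    rw [rising_succ, show (-(s + (k + 1 : ℕ) : ℂ)) + 1 = -(s + k : ℂ) by push_cast; ring,
      mul_assoc, ih, ← add_assoc, Nat.factorial_succ]
    push_cast
    ring

/-- With s = m + i - 1, the factorials (m + 3i)! = (m + 3i) (s + 2i)! nearly cancel in the ratio of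
the rising factorials, leaving (m + 3i) s! / m!, which is `girard m i` times i!. -/
lemma rising_eq_girard (m i : ℕ) (h : 0 < m + i) :
    rising (-(m + 3 * i : ℂ)) (3 * i) =
      (-1) ^ i * girard m i * i.factorial * rising (-(m + 3 * i : ℂ) + 1) (2 * i) := by
  obtain ⟨s, hs⟩ : ∃ s, m + i = s + 1 := ⟨m + i - 1, by lia⟩
  have h1 := rising_neg_mul_factorial m (3 * i)
  have h2 := rising_neg_mul_factorial s (2 * i)
  have h3 : (girard m i * i.factorial * m.factorial : ℂ) = (m + 3 * i) * s.factorial := by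
    exact_mod_cast girard_mul_factorial m i s hs
  have hs' : (m + i : ℂ) = s + 1 := by exact_mod_cast hs
  rw [show m + 3 * i = (s + 2 * i) + 1 by lia, Nat.factorial_succ] at h1
  push_cast at h1 h2
  rw [show -(m + 3 * i : ℂ) + 1 = -(s + 2 * i : ℂ) by linear_combination -hs']
  rw [pow_mul, show (-1 : ℂ) ^ 3 = -1 by norm_num] at h1
  rw [pow_mul, show (-1 : ℂ) ^ 2 = 1 by norm_num, one_pow, one_mul] at h2
  have hm : (m.factorial : ℂ) ≠ 0 := by exact_mod_cast m.factorial_ne_zero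
  have hs0 : (s.factorial : ℂ) ≠ 0 := by exact_mod_cast s.factorial_ne_zero
  refine mul_right_cancel₀ (mul_ne_zero hm hs0) ?_
  linear_combination s.factorial * h1 - (-1) ^ i * rising (-(s + 2 * i : ℂ)) (2 * i) * s.factorial * h3
    - (-1) ^ i * (m + 3 * i) * s.factorial * h2
    - (-1) ^ i * (s + 2 * i).factorial * s.factorial * hs'

/-- The factors run from -(s + 2i) to -(s + 1) with s = m + i - 1 ≥ 0, and never reach zero. -/
lemma rising_ne_zero (m i : ℕ) (h : 0 < m + i) : rising (-(m + 3 * i : ℂ) + 1) (2 * i) ≠ 0 := by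
  obtain ⟨s, hs⟩ : ∃ s, m + i = s + 1 := ⟨m + i - 1, by lia⟩
  have h2 := rising_neg_mul_factorial s (2 * i)
  have hs' : (m + i : ℂ) = s + 1 := by exact_mod_cast hs
  push_cast at h2
  rw [show -(m + 3 * i : ℂ) + 1 = -(s + 2 * i : ℂ) by linear_combination -hs']
  intro h0
  rw [h0, zero_mul, pow_mul, show (-1 : ℂ) ^ 2 = 1 by norm_num, one_pow, one_mul] at h2
  exact (s + 2 * i).factorial_ne_zero (by exact_mod_cast h2.symm)

section

variable {R : Type*} [CommRing R]

/-- The power sums of the roots of `X³ - a X² + b`, by the formula of Girard and Waring. -/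
def girardSum (a b : R) (k : ℕ) : R :=
  ∑ i ∈ Finset.range (k / 3 + 1), girard (k - 3 * i) i * a ^ (k - 3 * i) * (-b) ^ i

lemma girardSum_add_three (a b : R) (k : ℕ) :
    girardSum a b (k + 3) = a * girardSum a b (k + 2) - b * girardSum a b k := by
  -- The Pascal-type rule for `girard`, term by term. When 3i = k the order k + 2 sum has no
  -- matching term, and both remaining coefficients are 3; the `if` keeps truncated subtraction from
  -- inventing one.
  have key : ∀ i ∈ Finset.range (k / 3 + 1),
      (girard (k + 3 - 3 * (i + 1)) (i + 1) : R) * a ^ (k + 3 - 3 * (i + 1)) * (-b) ^ (i + 1) =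
      a * (if 3 * i < k then
        girard (k + 2 - 3 * (i + 1)) (i + 1) * a ^ (k + 2 - 3 * (i + 1)) * (-b) ^ (i + 1) else 0)
      - b * (girard (k - 3 * i) i * a ^ (k - 3 * i) * (-b) ^ i) := by
    intro i hi
    have hi' : 3 * i ≤ k := by have := Finset.mem_range.mp hi; lia
    split_ifs with h
    · obtain ⟨m, rfl⟩ : ∃ m, k = 3 * i + m + 1 := ⟨k - 3 * i - 1, by lia⟩
      rw [show 3 * i + m + 1 + 3 - 3 * (i + 1) = m + 1 by lia,
        show 3 * i + m + 1 + 2 - 3 * (i + 1) = m by lia, show 3 * i + m + 1 - 3 * i = m + 1 by lia]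
      simp only [girard]
      push_cast
      ring
    · obtain rfl : k = 3 * i := by lia
      rw [show 3 * i + 3 - 3 * (i + 1) = 0 by lia, Nat.sub_self]
      simp only [girard]
      push_cast
      ring
  have h2 : girardSum a b (k + 2) = a ^ (k + 2) + ∑ i ∈ Finset.range (k / 3 + 1),
      if 3 * i < k then
        girard (k + 2 - 3 * (i + 1)) (i + 1) * a ^ (k + 2 - 3 * (i + 1)) * (-b) ^ (i + 1)
      else 0 := by
    rw [girardSum, Finset.sum_range_succ', add_comm, ← Finset.sum_filter]
    congr 1
    · simp [girard]
    · refine Finset.sum_congr ?_ fun _ _ ↦ rfl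
      ext i
      simp only [Finset.mem_range, Finset.mem_filter]
      lia
  rw [h2, girardSum, show (k + 3) / 3 + 1 = k / 3 + 1 + 1 by lia, Finset.sum_range_succ',
    Finset.sum_congr rfl key, Finset.sum_sub_distrib, ← Finset.mul_sum, ← Finset.mul_sum,
    girardSum]
  simp only [mul_zero, Nat.sub_zero, girard, pow_zero]
  push_cast
  ring

/-- Multiplying the cubic by powers of a root gives Newton's recurrence, which the Girard sums also
satisfy; the orders 0, 1, 2 are compared directly. -/
lemma sum_pow_eq_girardSum {a b x y z : R} (hx : x ^ 3 = a * x ^ 2 - b)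
    (hy : y ^ 3 = a * y ^ 2 - b) (hz : z ^ 3 = a * z ^ 2 - b) (h1 : x + y + z = a)
    (h2 : x * y + y * z + z * x = 0) (k : ℕ) :
    x ^ k + y ^ k + z ^ k = girardSum a b k := by
  induction k using Nat.strong_induction_on with
  | _ k ih =>
    match k with
    | 0 => simp [girardSum, girard]; norm_num
    | 1 => simpa [girardSum, girard] using h1
    | 2 =>
      simp only [girardSum, Nat.reduceDiv, zero_add, Finset.sum_range_one, mul_zero, Nat.sub_zero,
        pow_zero, girard]
      push_cast
      linear_combination (x + y + z + a) * h1 - 2 * h2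
    | k + 3 =>
      rw [girardSum_add_three, ← ih (k + 2) (by lia), ← ih k (by lia)]
      linear_combination x ^ k * hx + y ^ k * hy + z ^ k * hz

end

/-! ### The coefficients ψ_j -/

lemma psi_eq {n m j r : ℕ} (hr : n + r = 2 ^ m) (hj : j ≤ r) :
    psi n m j = (256⁻¹ : ℂ) ^ j * j.factorial *
      rising (-((3 * (r - j) : ℕ) + 3 * j : ℂ) + 1) (2 * j) := by
  have hr' : (n + r : ℂ) = 2 ^ m := by exact_mod_cast hr
  have h8 : (2 : ℂ) ^ (-8 * j : ℤ) = (256⁻¹ : ℂ) ^ j := by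
    rw [zpow_mul, zpow_natCast]; norm_num
  rw [psi, h8]
  push_cast [Nat.cast_sub hj]
  rw [← hr']
  ring_nf

lemma psi_ne_zero {n m j r : ℕ} (hr : n + r = 2 ^ m) (hr0 : 0 < r) (hj : j ≤ r) :
    psi n m j ≠ 0 := by
  rw [psi_eq hr hj]
  refine mul_ne_zero (mul_ne_zero (by simp) ?_) (rising_ne_zero _ _ (by lia))
  exact_mod_cast j.factorial_ne_zero

lemma psi_inv_mul_rising {n m j r : ℕ} (hr : n + r = 2 ^ m) (hr0 : 0 < r) (hj : j ≤ r) :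
    (psi n m j)⁻¹ * rising (3 * (n : ℂ) - 3 * 2 ^ m) (3 * j) =
      (-256) ^ j * girard (3 * r - 3 * j) j := by
  rw [inv_mul_eq_iff_eq_mul₀ (psi_ne_zero hr hr0 hj), psi_eq hr hj]
  have hr' : (n + r : ℂ) = 2 ^ m := by exact_mod_cast hr
  have h := rising_eq_girard (3 * (r - j)) j (by lia)
  rw [show 3 * (n : ℂ) - 3 * 2 ^ m = -((3 * (r - j) : ℕ) + 3 * j : ℂ) by
    push_cast [Nat.cast_sub hj]; rw [← hr']; ring, h, ← Nat.mul_sub]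
  have : ((256⁻¹ : ℂ)) ^ j * (-256) ^ j = (-1) ^ j := by rw [← mul_pow]; norm_num
  rw [← this]
  ring

/-! ### Serre's trace as a sum over conjugates -/

lemma U_smul (p : ℕ) (c : ℂ) (f : PowerSeries ℂ) : U p (c • f) = c • U p f := by
  ext i
  simp [U]

/-- The operator `U₂` as an average over `τ / 2` and `(τ + 1) / 2`. -/
lemma two_smul_U_two_qExpansion {f G : ℍ → ℂ} (hG : G ∈ qAlg) (hf : f ∈ qAlg)
    (h : ∀ τ, f τ = G (half τ) + G (half ((1 : ℝ) +ᵥ τ))) :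
    (2 : ℂ) • U 2 (qExpansion 1 G) = qExpansion 1 f := by
  have hs (τ : ℍ) : HasSum (fun i ↦ ((2 : ℂ) • U 2 (qExpansion 1 G)).coeff i • 𝕢 1 τ ^ i) (f τ) := by
    have h1 := (hasSum_qExpansion_of_mem hG (half τ)).add
      (hasSum_qExpansion_of_mem hG (half ((1 : ℝ) +ᵥ τ)))
    rw [← h, qParam_half_vadd] at h1
    generalize qExpansion 1 G = p at h1 ⊢
    have hx := qParam_half_sq τ
    generalize 𝕢 1 (half τ) = x at h1 hx
    -- The two points have parameters x and -x with x² = q, so odd powers cancel and even ones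
    -- double.
    have h2 := ((mul_right_injective₀ (two_ne_zero (α := ℕ))).hasSum_iff fun i hi ↦ ?_).mpr h1
    · convert h2 using 1
      ext i
      simp only [Function.comp_apply, U, map_smul, PowerSeries.coeff_mk, smul_eq_mul]
      rw [(even_two_mul i).neg_pow, pow_mul, hx]
      ring
    · have : Odd i := by
        rw [← Nat.not_even_iff_odd]
        rintro ⟨y, rfl⟩
        exact hi ⟨y, by ring⟩
      rw [this.neg_pow, smul_neg, add_neg_cancel]
  ext i
  have h1 := hasFPowerSeriesOnBall_cuspFunction one_pos (analyticAt_cuspFunction hf) hs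
  have h2 := hasFPowerSeriesOnBall_cuspFunction one_pos (analyticAt_cuspFunction hf)
    (hasSum_qExpansion_of_mem hf)
  simpa using congrArg (FormalMultilinearSeries.coeff · i)
    (h1.hasFPowerSeriesAt.eq_formalMultilinearSeries h2.hasFPowerSeriesAt)

lemma W_smul (τ : ℍ) : W • τ = ModularGroup.S • double τ := by
  ext
  rw [coe_smul_of_det_pos (by simp [W]), coe_S_smul, coe_double]
  simp [W, num, denom]

lemma denom_W (τ : ℍ) : denom W τ = double τ := by
  simp [W, denom, coe_double]

variable {n m r : ℕ}

/-- The n factors λ absorb 3n of the factors h₀ and become Δⁿ; since 3·2^m is even for m ≥ 1, the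
sign in g = -15 h₀ is lost. -/
lemma traceInput_eq (hm : 1 ≤ m) (hr : n + r = 2 ^ m) (τ : ℍ) :
    traceInput n m τ = 15 ^ (3 * 2 ^ m) * (h₀ τ ^ (3 * r) * discriminant τ ^ n) := by
  have hg : g τ = -(15 * h₀ τ) := by rw [g, h₀]; ring
  have he : Even (3 * 2 ^ m) := by
    rw [Nat.even_mul, Nat.even_pow]; right; exact ⟨even_two, by lia⟩
  rw [traceInput, hg, he.neg_pow, ← h₀_cube_mul_hauptmodul, mul_pow, mul_pow, ← pow_mul, ← hr]
  ring

/-- Since W τ = S(2τ), the covariance under `S` turns h₀ into h₁ at 2τ and its factor cancels the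
denominator of the slash; the power of 2 is det(W)^(k/2). -/
lemma slash_traceInput_eq (hm : 1 ≤ m) (hr : n + r = 2 ^ m) (τ : ℍ) :
    slash (12 * 2 ^ m) (traceInput n m) W τ = (2 ^ (6 * 2 ^ m) * 15 ^ (3 * 2 ^ m)) *
      (h₁ (double τ) ^ (3 * r) * discriminant (double τ) ^ n) := by
  have hd : ((W.det.val : ℝ) ^ (((12 * 2 ^ m : ℤ) : ℝ) / 2) : ℝ) = 2 ^ (6 * 2 ^ m) := by
    rw [show (W.det.val : ℝ) = 2 by simp [W], ← Real.rpow_natCast]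
    congr 1
    push_cast
    ring
  have h0 : (double τ : ℂ) ≠ 0 := UpperHalfPlane.ne_zero _
  have hz : (double τ : ℂ) ^ (-(12 * 2 ^ m) : ℤ) =
      (((double τ : ℂ) ^ 4) ^ (3 * r) * ((double τ : ℂ) ^ 12) ^ n)⁻¹ := by
    rw [zpow_neg, ← pow_mul, ← pow_mul, ← pow_add, ← zpow_natCast]
    congr 2
    push_cast [← hr]
    have : (n + r : ℤ) = 2 ^ m := by exact_mod_cast hr
    rw [← this]
    ring
  rw [slash, hd, denom_W, W_smul, traceInput_eq hm hr, h₀_S, isLevelOne_discriminant.S, hz,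
    mul_pow, mul_pow]
  simp only [zpow_ofNat]
  push_cast
  field_simp

lemma trace_isLevelOne (hr : n + r = 2 ^ m) :
    IsLevelOne (12 * 2 ^ m) ((h₀ ^ (3 * r) + h₁ ^ (3 * r) + h₂ ^ (3 * r)) * discriminant ^ n) := by
  refine ⟨mul_mem (add_mem (add_mem (pow_mem h₀_mem _) (pow_mem h₁_mem _)) (pow_mem h₂_mem _))
    (pow_mem isLevelOne_discriminant.mem _), fun τ ↦ ?_, fun τ ↦ ?_⟩
  · simp only [Pi.add_apply, Pi.mul_apply, Pi.pow_apply, h₀_T, h₁_T, h₂_T,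
      isLevelOne_discriminant.T]
    ring
  · have hz : (τ : ℂ) ^ (12 * 2 ^ m : ℤ) = ((τ : ℂ) ^ 4) ^ (3 * r) * ((τ : ℂ) ^ 12) ^ n := by
      rw [← pow_mul, ← pow_mul, ← pow_add, ← zpow_natCast]
      congr 1
      have : (n + r : ℤ) = 2 ^ m := by exact_mod_cast hr
      push_cast
      rw [← this]
      ring
    simp only [Pi.add_apply, Pi.mul_apply, Pi.pow_apply, h₀_S, h₁_S, h₂_S,
      isLevelOne_discriminant.S, zpow_ofNat, mul_pow]
    rw [hz]
    ring

/-- `U 2` undoes the doubling and averages over the two half points, producing the `h₁` and `h₂`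
terms together; they are kept as one sum because `T` exchanges them. -/
lemma lam_eq_qExpansion (hm : 1 ≤ m) (hr : n + r = 2 ^ m) :
    lam n m = qExpansion 1 ((15 : ℂ) ^ (3 * 2 ^ m) •
      ((h₀ ^ (3 * r) + h₁ ^ (3 * r) + h₂ ^ (3 * r)) * discriminant ^ n)) := by
  have hΔ := isLevelOne_discriminant
  have hA : h₀ ^ (3 * r) * discriminant ^ n ∈ qAlg :=
    mul_mem (pow_mem (show h₀ ∈ qAlg from ⟨h₀_mem, h₀_T⟩) _) (pow_mem hΔ.mem_qAlg _)
  have hB : (h₁ ^ (3 * r) + h₂ ^ (3 * r)) * discriminant ^ n ∈ qAlg := by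
    refine ⟨mul_mem (add_mem (pow_mem h₁_mem _) (pow_mem h₂_mem _)) (pow_mem hΔ.mem _), fun τ ↦ ?_⟩
    simp only [Pi.add_apply, Pi.mul_apply, Pi.pow_apply, h₁_T, h₂_T, hΔ.T]
    ring
  have hG : (fun τ ↦ h₁ (double τ) ^ (3 * r) * discriminant (double τ) ^ n) ∈ qAlg := by
    refine ⟨comp_affine (mul_mem (pow_mem h₁_mem (3 * r)) (pow_mem hΔ.mem n)) (by norm_num)
      coe_double', fun τ ↦ ?_⟩
    simp only [double_vadd, h₁_T, h₂_T, hΔ.T]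
  have hU := two_smul_U_two_qExpansion hG hB fun τ ↦ by
    simp only [double_half, h₁_T, hΔ.T, Pi.mul_apply, Pi.add_apply, Pi.pow_apply]
    ring
  have h1 : traceInput n m = (15 : ℂ) ^ (3 * 2 ^ m) • (h₀ ^ (3 * r) * discriminant ^ n) :=
    funext fun τ ↦ traceInput_eq hm hr τ
  have h2 : slash (12 * 2 ^ m) (traceInput n m) W = ((2 : ℂ) ^ (6 * 2 ^ m) * 15 ^ (3 * 2 ^ m)) •
      fun τ ↦ h₁ (double τ) ^ (3 * r) * discriminant (double τ) ^ n :=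
    funext fun τ ↦ slash_traceInput_eq hm hr τ
  -- Serre's normalisation leaves exactly the factor 2 that turns the average `U 2` into a sum.
  have h3 : (2 : ℂ) ^ (1 - 6 * 2 ^ m : ℤ) * (2 ^ (6 * 2 ^ m) * 15 ^ (3 * 2 ^ m)) =
      15 ^ (3 * 2 ^ m) * 2 := by
    rw [zpow_sub₀ two_ne_zero, zpow_one,
      show (2 : ℂ) ^ (6 * 2 ^ m : ℤ) = 2 ^ (6 * 2 ^ m) by rw [← zpow_natCast]; norm_cast]
    field_simp
  rw [lam, h2, h1, qExpansion_smul (analyticAt_cuspFunction hA),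
    qExpansion_smul (analyticAt_cuspFunction hG), U_smul, smul_smul, h3, mul_smul, hU, ← smul_add,
    ← qExpansion_add (analyticAt_cuspFunction hA) (analyticAt_cuspFunction hB),
    ← qExpansion_smul (analyticAt_cuspFunction (add_mem hA hB))]
  congr 2
  ring

/-! ### Transfer to q-series and to polynomials in E₄, E₆ -/

lemma trace_eq_girardSum (k : ℕ) :
    h₀ ^ k + h₁ ^ k + h₂ ^ k = girardSum (⇑E₄) ((256 : ℂ) • discriminant) k :=
  sum_pow_eq_girardSum (funext h₀_root) (funext h₁_root) (funext h₂_root) (funext sum_h)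
    (funext sum_mul_h) k

lemma map_girardSum {R S : Type*} [CommRing R] [CommRing S] (φ : R →+* S) (a b : R) (k : ℕ) :
    φ (girardSum a b k) = girardSum (φ a) (φ b) k := by
  simp [girardSum]

lemma discriminant_eq : discriminant = (1 / 1728 : ℂ) • ((⇑E₄) ^ 3 - (⇑E₆) ^ 2) := by
  ext τ
  rw [discriminant_eq_E₄_cube_sub_E₆_sq, Pi.smul_apply, smul_eq_mul, Pi.sub_apply, Pi.pow_apply,
    Pi.pow_apply]
  ring

lemma qExpansion_discriminant : qExpansion 1 discriminant = Deltaq := by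
  have h : (⟨discriminant, isLevelOne_discriminant.mem_qAlg⟩ : qAlg) =
      (1 / 1728 : ℂ) • ((⟨E₄, isLevelOne_E₄.mem_qAlg⟩ : qAlg) ^ 3 -
        (⟨E₆, isLevelOne_E₆.mem_qAlg⟩ : qAlg) ^ 2) := Subtype.ext discriminant_eq
  rw [← qHom_mk isLevelOne_discriminant.mem_qAlg, h, map_smul, map_sub, map_pow, map_pow]
  rfl

/-- Girard sums commute with ring homomorphisms, so the identity of functions passes through `qHom`
to q-series. -/
lemma lam_eq_girardSum (hm : 1 ≤ m) (hr : n + r = 2 ^ m) :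
    lam n m = (15 : ℂ) ^ (3 * 2 ^ m) •
      (girardSum E4q ((256 : ℂ) • Deltaq) (3 * r) * Deltaq ^ n) := by
  let e : qAlg := ⟨E₄, isLevelOne_E₄.mem_qAlg⟩
  let d : qAlg := ⟨discriminant, isLevelOne_discriminant.mem_qAlg⟩
  have h : ((15 : ℂ) ^ (3 * 2 ^ m) • (girardSum e ((256 : ℂ) • d) (3 * r) * d ^ n) : qAlg) =
      (15 : ℂ) ^ (3 * 2 ^ m) •
      ((h₀ ^ (3 * r) + h₁ ^ (3 * r) + h₂ ^ (3 * r)) * discriminant ^ n) := by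
    rw [trace_eq_girardSum]
    have := map_girardSum (qAlg.val : qAlg →+* (ℍ → ℂ)) e ((256 : ℂ) • d) (3 * r)
    change _ • (qAlg.val (girardSum e ((256 : ℂ) • d) (3 * r)) * _) = _
    exact congrArg (fun x ↦ (15 : ℂ) ^ (3 * 2 ^ m) • (x * discriminant ^ n)) this
  have hd : qHom d = Deltaq := qExpansion_discriminant
  have he : qHom e = E4q := rfl
  rw [lam_eq_qExpansion hm hr, ← h, ← qHom_mk (Subtype.property _), Subtype.coe_eta, map_smul,
    map_mul, map_pow, hd, ← he, ← hd, ← map_smul]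
  congr 2
  exact map_girardSum (qHom : qAlg →+* PowerSeries ℂ) e ((256 : ℂ) • d) (3 * r)

/-- `Δ` as a polynomial in `E₄` and `E₆`. -/
def discriminantPoly : MvPolynomial (Fin 2) ℂ :=
  MvPolynomial.C (1 / 1728) * (MvPolynomial.X 0 ^ 3 - MvPolynomial.X 1 ^ 2)

lemma isWeightedHomogeneous_discriminantPoly :
    discriminantPoly.IsWeightedHomogeneous ![4, 6] 12 := by
  have h0 := (MvPolynomial.isWeightedHomogeneous_X ℂ ![4, 6] (0 : Fin 2)).pow 3
  have h1 := (MvPolynomial.isWeightedHomogeneous_X ℂ ![4, 6] (1 : Fin 2)).pow 2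
  have h2 := (MvPolynomial.isWeightedHomogeneous_C ![4, 6] (1 / 1728 : ℂ)).mul
    ((MvPolynomial.weightedHomogeneousSubmodule ℂ ![4, 6] 12).sub_mem h0 h1)
  rwa [zero_add] at h2

lemma isWeightedHomogeneous_girardSum {a b : MvPolynomial (Fin 2) ℂ} {w : Fin 2 → ℕ} {k : ℕ}
    (ha : a.IsWeightedHomogeneous w k) (hb : b.IsWeightedHomogeneous w (3 * k)) (l : ℕ) :
    (girardSum a b l).IsWeightedHomogeneous w (k * l) := by
  refine MvPolynomial.IsWeightedHomogeneous.sum _ _ _ fun i hi ↦ ?_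
  have hi' : 3 * i ≤ l := by have := Finset.mem_range.mp hi; lia
  have hc : (girard (l - 3 * i) i : MvPolynomial (Fin 2) ℂ).IsWeightedHomogeneous w 0 := by
    simpa using MvPolynomial.isWeightedHomogeneous_C w (girard (l - 3 * i) i : ℂ)
  have hb' : (-b).IsWeightedHomogeneous w (3 * k) :=
    (MvPolynomial.weightedHomogeneousSubmodule ℂ w (3 * k)).neg_mem hb
  have := (hc.mul (ha.pow (l - 3 * i))).mul (hb'.pow i)
  obtain ⟨j, rfl⟩ := Nat.exists_eq_add_of_le hi'
  simp only [Nat.add_sub_cancel_left, smul_eq_mul] at this ⊢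
  convert this using 1
  ring

end SerreSequence
end

open SerreSequence in
theorem mainTheorem4 (n m : ℕ) (hn : 1 ≤ n) (hm : 1 ≤ m) (hnm : n < 2 ^ m) :
    (∀ j ∈ Finset.range (2 ^ m - n + 1), SerreSequence.psi n m j ≠ 0) ∧
    SerreSequence.lam n m =
      ∑ j ∈ Finset.range (2 ^ m - n + 1),
        ((SerreSequence.psi n m j)⁻¹ *
            SerreSequence.rising (3 * (n : ℂ) - 3 * 2 ^ m) (3 * j) * 15 ^ (3 * 2 ^ m)) •
          (SerreSequence.E4q ^ (3 * 2 ^ m - 3 * n - 3 * j) * SerreSequence.Deltaq ^ (n + j)) ∧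
    ∃ (F : ModularForm 𝒮ℒ (12 * 2 ^ m)) (P : MvPolynomial (Fin 2) ℂ),
      P.IsWeightedHomogeneous ![4, 6] (12 * 2 ^ m) ∧
      (∀ τ : ℍ, F τ = MvPolynomial.eval ![E₄ τ, E₆ τ] P) ∧
      qExpansion 1 F = SerreSequence.lam n m := by
  obtain ⟨r, hr0, hr⟩ : ∃ r, 0 < r ∧ n + r = 2 ^ m := ⟨2 ^ m - n, by lia, by lia⟩
  rw [show 2 ^ m - n + 1 = r + 1 by lia]
  refine ⟨fun j hj ↦ psi_ne_zero hr hr0 (by have := Finset.mem_range.mp hj; lia), ?_, ?_⟩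
  · rw [lam_eq_girardSum hm hr, girardSum, show 3 * r / 3 + 1 = r + 1 by lia, Finset.sum_mul,
      Finset.smul_sum]
    refine Finset.sum_congr rfl fun j hj ↦ ?_
    rw [psi_inv_mul_rising hr hr0 (by have := Finset.mem_range.mp hj; lia),
      show 3 * 2 ^ m - 3 * n - 3 * j = 3 * r - 3 * j by lia, show -((256 : ℂ) • Deltaq) = (-256 : ℂ) • Deltaq from
        (_root_.neg_smul _ _).symm, smul_pow,
      ← map_natCast (PowerSeries.C (R := ℂ)), ← PowerSeries.smul_eq_C_mul]
    simp only [smul_mul_assoc, mul_smul_comm, smul_smul]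
    congr 1
    · ring
    · ring
  -- The same Girard sum, formed in the polynomial ring; evaluation at (E₄, E₆) recovers the trace
  -- pointwise.
  · let P : MvPolynomial (Fin 2) ℂ := MvPolynomial.C (15 ^ (3 * 2 ^ m)) *
      (girardSum (MvPolynomial.X 0) (MvPolynomial.C 256 * discriminantPoly) (3 * r) *
        discriminantPoly ^ n)
    refine ⟨(15 : ℂ) ^ (3 * 2 ^ m) • (trace_isLevelOne hr).toModularForm, P, ?_, fun τ ↦ ?_, ?_⟩
    · have hb := (MvPolynomial.isWeightedHomogeneous_C ![4, 6] (256 : ℂ)).mul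
        isWeightedHomogeneous_discriminantPoly
      rw [zero_add] at hb
      have h := (MvPolynomial.isWeightedHomogeneous_C ![4, 6] ((15 : ℂ) ^ (3 * 2 ^ m))).mul
        ((isWeightedHomogeneous_girardSum (k := 4)
          (MvPolynomial.isWeightedHomogeneous_X ℂ ![4, 6] (0 : Fin 2)) hb (3 * r)).mul
          (isWeightedHomogeneous_discriminantPoly.pow n))
      convert h using 1
      rw [← hr, smul_eq_mul]
      ring
    · have hD : MvPolynomial.eval ![E₄ τ, E₆ τ] discriminantPoly = discriminant τ := by
        rw [discriminant_eq]
        simp [discriminantPoly]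
      have ht := map_girardSum (Pi.evalRingHom (fun _ : ℍ ↦ ℂ) τ) E₄ ((256 : ℂ) • discriminant)
        (3 * r)
      rw [← trace_eq_girardSum] at ht
      simp only [P, map_mul, map_pow, map_girardSum, MvPolynomial.eval_C, MvPolynomial.eval_X, hD]
      exact congrArg (fun x ↦ (15 : ℂ) ^ (3 * 2 ^ m) * (x * discriminant τ ^ n)) ht
    · rw [lam_eq_qExpansion hm hr]
      rfl
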